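/- Let $F_n$ and $L_n$ be the Fibonacci and Lucas numbers ($F_0=0$, $F_1=1$, $L_0=2$, $L_1=1$, both satisfying $X_n=X_{n-1}+X_{n-2}$ for $n\ge 2$), let $\alpha=(1+\sqrt5)/2$ and $\beta=(1-\sqrt5)/2$, and let $\sqrt[3]{\cdot}$ denote the real cube root. For every integer $r\ge 1$, \begin{align*} \sum_{k=1}^\infty &\frac{(-1)^{(k-1)(r-1)}\left(\frac{27}{5}\right)^k}{\binom{3k}{k}F_r^{2k}}=\frac{4}{L_r^2}\\ &+\frac{2\sqrt{15}}{3}\frac{F_r}{L_r^3}\left(2\big(\sqrt[3]{\alpha^{2r}}+\sqrt[3]{\beta^{2r}}\big)-(-1)^r\big(\sqrt[3]{\alpha^{4r}}+\sqrt[3]{\beta^{4r}}\big)\right)\arctan\left(\frac{\sqrt3}{2\sqrt[3]{\alpha^{2r}}+(-1)^r}\right)\\ &+\frac{(-1)^r\sqrt5}{3}\frac{F_r}{L_r^3}\left(2\big(\sqrt[3]{\alpha^{2r}}-\sqrt[3]{\beta^{2r}}\big)+(-1)^r\big(\sqrt[3]{\alpha^{4r}}-\sqrt[3]{\beta^{4r}}\big)\right)\log\left(\frac{\sqrt5\,\alpha^rF_r}{\big(\sqrt[3]{\alpha^{2r}}-(-1)^r\big)^3}\right),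 \end{align*} and for every integer $r\ge 2$, \begin{align*} \sum_{k=1}^\infty &\frac{(-1)^{r(k-1)}27^k}{\binom{3k}{k}L_r^{2k}}=\frac{4}{5F_r^2}\\ &+\frac{2\sqrt{15}}{75}\frac{L_r}{F_r^3}\left(2\big(\sqrt[3]{\alpha^{2r}}+\sqrt[3]{\beta^{2r}}\big)+(-1)^r\big(\sqrt[3]{\alpha^{4r}}+\sqrt[3]{\beta^{4r}}\big)\right)\arctan\left(\frac{\sqrt3}{2\sqrt[3]{\alpha^{2r}}-(-1)^r}\right)\\ &-\frac{(-1)^r\sqrt5}{75}\frac{L_r}{F_r^3}\left(2\big(\sqrt[3]{\alpha^{2r}}-\sqrt[3]{\beta^{2r}}\big)-(-1)^r\big(\sqrt[3]{\alpha^{4r}}-\sqrt[3]{\beta^{4r}}\big)\right)\log\left(\frac{L_r}{\big(\sqrt[3]{\alpha^{r}}+\sqrt[3]{\beta^{r}}\big)^3}\right). \end{align*} In both cases the series converges (absolutely). -/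

import Mathlib

/-- The Lucas numbers: `L 0 = 2`, `L 1 = 1`, `L (n + 2) = L (n + 1) + L n`. -/
def lucas : ℕ → ℕ
  | 0 => 2
  | 1 => 1
  | n + 2 => lucas (n + 1) + lucas n

/-- The real cube root, defined on all of `ℝ` (and odd). -/
noncomputable def cbrt (x : ℝ) : ℝ :=
  if 0 ≤ x then x ^ (1 / 3 : ℝ) else -((-x) ^ (1 / 3 : ℝ))

/-- `cbrt x` is a real number whose cube is `x`. -/
theorem cbrt_pow_three (x : ℝ) : cbrt x ^ 3 = x := by
  have key : ∀ y : ℝ, 0 ≤ y → (y ^ (1 / 3 : ℝ)) ^ 3 = y := by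
    intro y hy
    rw [← Real.rpow_natCast, ← Real.rpow_mul hy]
    norm_num
  unfold cbrt
  split_ifs with h
  · exact key x h
  · have h2 := key (-x) (by linarith)
    rw [Odd.neg_pow (by decide), h2, neg_neg]

/-! Both series are values of G(y) = ∑_{k≥1} y^k / C(3k,k), with radius of convergence 27/4. The
Beta integral 1/C(3k,k) = k ∫₀¹ t^(2k) (1-t)^(k-1) dt and summation under the integral sign give
G(y) = ∫₀¹ y t² / (1 - y t²(1-t))² dt (`hasSum_pow_div_choose`).

Substituting y = 27w³/(1+w³)² splits the cubic 1 - y t²(1-t) rationally in w into a linear and a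
positive quadratic factor. Hermite reduction removes the double poles, partial fractions give a
logarithm and an arctangent, and the values at 0 and 1 collapse to
`hasSum_pow_div_choose_closed_form`.

With s = (-1)^r and b the cube root of α^r, αβ = -1 gives √5 F_r = b³ - s/b³ and L_r = b³ + s/b³.
Hence w = -s b² yields y = -s(27/5)/F_r², and w = s b² yields y = 27s/L_r². Unconditional
summability in ℝ, as expressed by `HasSum`, is absolute convergence. -/

/-! ### Beta integrals and the integral representation of the series. -/

open intervalIntegral in
theorem integral_pow_mul_one_sub_pow (m n : ℕ) :
    ∫ t in (0 : ℝ)..1, t ^ m * (1 - t) ^ n = (m.factorial * n.factorial : ℝ) / (m + n + 1).factorial := by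
  induction n generalizing m with
  | zero =>
    simp only [pow_zero, mul_one, integral_pow, Nat.factorial_succ, add_zero]
    have := Nat.factorial_pos m
    push_cast
    field_simp
    simp
  | succ n ih =>
    -- Integration by parts: this product vanishes at both end points, so its derivative integrates
    -- to 0 and lowers the exponent of 1 - t.
    have hd : ∀ t ∈ Set.uIcc (0 : ℝ) 1, HasDerivAt (fun t : ℝ => t ^ (m + 1) * (1 - t) ^ (n + 1))
        ((m + 1) * (t ^ m * (1 - t) ^ (n + 1)) - (n + 1) * (t ^ (m + 1) * (1 - t) ^ n)) t := by
      intro t _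
      have h := (hasDerivAt_pow (m + 1) t).mul (((hasDerivAt_id t).const_sub 1).pow (n + 1))
      convert! h using 1
      simp
      ring
    have h := integral_eq_sub_of_hasDerivAt hd (Continuous.intervalIntegrable (by fun_prop) _ _)
    rw [integral_sub (Continuous.intervalIntegrable (by fun_prop) _ _)
      (Continuous.intervalIntegrable (by fun_prop) _ _), integral_const_mul, integral_const_mul,
      ih (m + 1)] at h
    have hm : ((m : ℝ) + 1) ≠ 0 := by positivity
    have e : m + 1 + n + 1 = m + (n + 1) + 1 := by ring
    rw [e] at h
    have hf : ((m + (n + 1) + 1).factorial : ℝ) ≠ 0 := by positivity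
    apply mul_left_cancel₀ hm
    simp only [Nat.factorial_succ m, Nat.factorial_succ n] at h ⊢
    push_cast at h ⊢
    simp at h
    rw [sub_eq_zero.1 h]
    ring

theorem inv_choose_eq_integral (n : ℕ) :
    ∫ t in (0 : ℝ)..1, (n + 1) * (t ^ (2 * n + 2) * (1 - t) ^ n) =
      1 / ((3 * (n + 1)).choose (n + 1) : ℝ) := by
  rw [intervalIntegral.integral_const_mul, integral_pow_mul_one_sub_pow,
    Nat.cast_choose ℝ (by omega : n + 1 ≤ 3 * (n + 1)),
    show 3 * (n + 1) - (n + 1) = 2 * n + 2 by omega, show 2 * n + 2 + n + 1 = 3 * (n + 1) by ring,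
    Nat.factorial_succ n]
  push_cast
  field_simp

/-- 27(4/27 - t² + t³) = (3t - 2)²(3t + 1); the maximum, at t = 2/3, is what produces the radius
27/4. -/
theorem abs_sq_mul_one_sub_le {t : ℝ} (h0 : 0 ≤ t) (h1 : t ≤ 1) : |t ^ 2 * (1 - t)| ≤ 4 / 27 := by
  rw [abs_of_nonneg (mul_nonneg (sq_nonneg t) (by linarith))]
  nlinarith [mul_nonneg (sq_nonneg (3 * t - 2)) (by linarith : 0 ≤ 3 * t + 1)]

theorem hasSum_pow_div_choose {y : ℝ} (hy : |y| < 27 / 4) :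
    HasSum (fun n : ℕ => y ^ (n + 1) / ((3 * (n + 1)).choose (n + 1) : ℝ))
      (∫ t in (0 : ℝ)..1, y * t ^ 2 / (1 - y * (t ^ 2 * (1 - t))) ^ 2) := by
  have hρ : ‖|y| * (4 / 27)‖ < 1 := by
    rw [Real.norm_of_nonneg (by positivity)]; linarith
  have hs := (hasSum_choose_mul_geometric_of_norm_lt_one' 1 hρ).summable
  have key : ∀ t ∈ Set.uIoc (0 : ℝ) 1, |y * (t ^ 2 * (1 - t))| ≤ |y| * (4 / 27) := by
    intro t ht
    rw [Set.uIoc_of_le zero_le_one] at ht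
    rw [abs_mul]
    exact mul_le_mul_of_nonneg_left (abs_sq_mul_one_sub_le ht.1.le ht.2) (abs_nonneg y)
  have h := intervalIntegral.hasSum_integral_of_dominated_convergence
    (a := (0 : ℝ)) (b := 1) (μ := MeasureTheory.volume)
    (F := fun (n : ℕ) t => y ^ (n + 1) * ((n + 1) * (t ^ (2 * n + 2) * (1 - t) ^ n)))
    (f := fun t => y * t ^ 2 / (1 - y * (t ^ 2 * (1 - t))) ^ 2)
    -- The dominating series is |y| ∑ (n+1) ρ^n with ρ = 4|y|/27 < 1, constant in t.
    (fun n _ => |y| * (((n + 1).choose 1 : ℝ) * (|y| * (4 / 27)) ^ n))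
    (fun n => (Continuous.aestronglyMeasurable (by fun_prop)))
    (fun n => Filter.Eventually.of_forall fun t ht => ?_)
    (Filter.Eventually.of_forall fun t _ => hs.mul_left _)
    intervalIntegrable_const
    (Filter.Eventually.of_forall fun t ht => ?_)
  · refine h.congr_fun ?_ 
    intro n
    rw [intervalIntegral.integral_const_mul, inv_choose_eq_integral]
    ring
  · have hz := key t ht
    rw [Set.uIoc_of_le zero_le_one] at ht
    have e : y ^ (n + 1) * ((n + 1) * (t ^ (2 * n + 2) * (1 - t) ^ n)) =
        (y * t ^ 2) * ((n + 1) * (y * (t ^ 2 * (1 - t))) ^ n) := by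
      rw [mul_pow, mul_pow]; ring
    rw [e, Real.norm_eq_abs, abs_mul, abs_mul, abs_mul, abs_pow _ n, Nat.choose_one_right]
    push_cast
    rw [abs_of_nonneg (by positivity : (0 : ℝ) ≤ n + 1), abs_of_nonneg (sq_nonneg t)]
    have ht2 : t ^ 2 ≤ 1 := pow_le_one₀ ht.1.le ht.2
    have := abs_nonneg y
    gcongr
    exact mul_le_of_le_one_right (abs_nonneg y) ht2
  · have hz := (key t ht).trans_lt (by linarith : |y| * (4 / 27) < 1)
    have := (hasSum_choose_mul_geometric_of_norm_lt_one' 1 (r := y * (t ^ 2 * (1 - t))) hz).mul_left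
      (y * t ^ 2)
    convert! this using 1
    · funext n
      rw [Nat.choose_one_right]
      push_cast
      rw [mul_pow y, mul_pow]
      ring
    · rw [Ring.inverse_eq_inv', div_eq_mul_inv, inv_pow]

/-! ### Evaluation of the integral by an explicit antiderivative. -/

/-- The addition formula behind the evaluation of the integral at its end points. -/
theorem arctan_sub_arctan_eq {w : ℝ} (hw : 1 < w ^ 2) :
    Real.arctan ((6 * w - (1 + w) ^ 2) / (√3 * (w ^ 2 - 1))) -
      Real.arctan (-(1 + w) ^ 2 / (√3 * (w ^ 2 - 1))) = 3 * Real.arctan (√3 / (2 * w - 1)) := by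
  have h3 : √3 ^ 2 = 3 := Real.sq_sqrt (by norm_num)
  have h3' : √3 ≠ 0 := by positivity
  have hne1 : w - 1 ≠ 0 := by rintro h; nlinarith
  have hne2 : w + 1 ≠ 0 := by rintro h; nlinarith
  have hne0 : w ≠ 0 := by rintro h; nlinarith
  have hw2 : w ^ 2 - 1 ≠ 0 := by linarith
  have hcase : 1 < w ∨ w < -1 := by
    rcases lt_abs.1 ((one_lt_sq_iff_one_lt_abs w).1 hw) with h | h
    · exact .inl h
    · exact .inr (by linarith)
  have hne3 : 2 * w - 1 ≠ 0 := by rcases hcase with h | h <;> intro h' <;> linarith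
  set θ := Real.arctan (√3 / (2 * w - 1)) with hθ
  -- Three additions of θ lead from one end point to the other: `a0` treats the value at t = 0, `a1`
  -- and `a2` the value at t = 1. The terms ± arctan(1/√3) cancel, and each product of tangents is
  -- below 1, so no multiple of π appears.
  have a0 : θ + Real.arctan (1 / √3) = Real.arctan ((1 + w) ^ 2 / (√3 * (w ^ 2 - 1))) := by
    rw [hθ, Real.arctan_add]
    · congr 1
      rw [show w ^ 2 - 1 = (w - 1) * (w + 1) by ring]
      have : 1 - √3 / (2 * w - 1) * (1 / √3) = 2 * (w - 1) / (2 * w - 1) := by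
        field_simp; ring
      rw [this]
      field_simp
      rw [h3]; ring
    · rw [show √3 / (2 * w - 1) * (1 / √3) = 1 / (2 * w - 1) by field_simp]
      rcases hcase with h | h
      · rw [div_lt_one (by linarith)]; linarith
      · exact (div_neg_of_pos_of_neg one_pos (by linarith)).trans one_pos
  have a1 : θ + Real.arctan (-(1 / √3)) = Real.arctan ((2 - w) / (√3 * w)) := by
    rw [hθ, Real.arctan_add]
    · congr 1
      have : 1 - √3 / (2 * w - 1) * (-(1 / √3)) = 2 * w / (2 * w - 1) := by
        field_simp; ring
      rw [this]
      field_simp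
      rw [h3]; ring
    · rw [show √3 / (2 * w - 1) * (-(1 / √3)) = -1 / (2 * w - 1) by field_simp]
      rcases hcase with h | h
      · exact (div_neg_of_neg_of_pos (by norm_num) (by linarith)).trans one_pos
      · rw [div_lt_one_of_neg (by linarith)]; linarith
  have a2 : θ + Real.arctan ((2 - w) / (√3 * w)) =
      Real.arctan ((6 * w - (1 + w) ^ 2) / (√3 * (w ^ 2 - 1))) := by
    have e : √3 / (2 * w - 1) * ((2 - w) / (√3 * w)) = (2 - w) / ((2 * w - 1) * w) := by
      field_simp
    have hpos : 0 < (2 * w - 1) * w := by rcases hcase with h | h <;> nlinarith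
    rw [hθ, Real.arctan_add]
    · congr 1
      have : 1 - √3 / (2 * w - 1) * ((2 - w) / (√3 * w)) = 2 * (w ^ 2 - 1) / ((2 * w - 1) * w) := by
        rw [e]; field_simp; ring
      rw [this]
      field_simp
      rw [h3]; ring
    · rw [e, div_lt_one hpos]; nlinarith
  rw [neg_div, Real.arctan_neg, ← a0, ← a2, ← a1, Real.arctan_neg]
  ring

/-- Hermite reduction: the numerator is chosen so that the rational part absorbs the squared
denominator, leaving only a multiple of (1 + 3t) / (1 - y t²(1-t)). The factor 4y - 27 comes from
the discriminant of the cubic. -/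
theorem hasDerivAt_hermite_part {y t : ℝ} (hy : 4 * y - 27 ≠ 0)
    (hP : 1 - y * (t ^ 2 * (1 - t)) ≠ 0) :
    HasDerivAt (fun t : ℝ => (9 + 2 * y * t - 6 * y * t ^ 2) /
        ((4 * y - 27) * (1 - y * (t ^ 2 * (1 - t)))))
      (y * t ^ 2 / (1 - y * (t ^ 2 * (1 - t))) ^ 2 +
        2 * y * (1 + 3 * t) / ((4 * y - 27) * (1 - y * (t ^ 2 * (1 - t))))) t := by
  have hn : HasDerivAt (fun t : ℝ => 9 + 2 * y * t - 6 * y * t ^ 2) (2 * y - 12 * y * t) t := by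
    have := (((hasDerivAt_id t).const_mul (2 * y)).const_add 9).sub
      ((hasDerivAt_pow 2 t).const_mul (6 * y))
    convert! this using 1
    simp; ring
  have hd : HasDerivAt (fun t : ℝ => (4 * y - 27) * (1 - y * (t ^ 2 * (1 - t))))
      ((4 * y - 27) * (3 * y * t ^ 2 - 2 * y * t)) t := by
    have := ((((hasDerivAt_pow 2 t).mul ((hasDerivAt_id t).const_sub 1)).const_mul y).const_sub
      1).const_mul (4 * y - 27)
    convert! this using 1
    simp; ring
  convert! hn.div hd (mul_ne_zero hy hP) using 1
  generalize hp : 1 - y * (t ^ 2 * (1 - t)) = p at *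
  generalize hc : 4 * y - 27 = c at *
  field_simp
  rw [← hp, ← hc]
  ring

/-- Partial fractions over the linear and quadratic factors of the cubic; this derivative is the
negative of the remainder left by Hermite reduction. -/
theorem hasDerivAt_log_arctan_part {w t : ℝ} (hw : 1 < w ^ 2)
    (hl : w ^ 2 - w + 1 + 3 * w * t ≠ 0) (h1 : w ^ 3 - 1 ≠ 0) :
    HasDerivAt (fun t : ℝ =>
      w ^ 3 * (w ^ 3 + 1) / (3 * (w ^ 3 - 1) ^ 3) * (
        (2 * (w - 1 / w) - (w ^ 2 - 1 / w ^ 2)) *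
          (2 / 3 * Real.log (w ^ 2 - w + 1 + 3 * w * t) - 1 / 3 *
            Real.log ((w ^ 2 - w + 1) * (1 + w) ^ 2 - 3 * w * (1 + w) ^ 2 * t + 9 * w ^ 2 * t ^ 2)) +
        (2 * (w + 1 / w) + (w ^ 2 + 1 / w ^ 2)) *
          (2 / √3 * Real.arctan ((6 * w * t - (1 + w) ^ 2) / (√3 * (w ^ 2 - 1))))))
      (2 * w ^ 3 * (1 + w ^ 3) ^ 2 / (w ^ 3 - 1) ^ 2 * (1 + 3 * t) /
        ((w ^ 2 - w + 1 + 3 * w * t) *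
          ((w ^ 2 - w + 1) * (1 + w) ^ 2 - 3 * w * (1 + w) ^ 2 * t + 9 * w ^ 2 * t ^ 2))) t := by
  have h3 : √3 ^ 2 = 3 := Real.sq_sqrt (by norm_num)
  have h3' : √3 ≠ 0 := by positivity
  have hw0 : w ≠ 0 := by rintro h; nlinarith
  have hw2 : w ^ 2 - 1 ≠ 0 := by linarith
  -- Completing the square: four times the quadratic is (6wt - (1+w)²)² + 3(w² - 1)².
  have hQ : 0 < (w ^ 2 - w + 1) * (1 + w) ^ 2 - 3 * w * (1 + w) ^ 2 * t + 9 * w ^ 2 * t ^ 2 := by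
    nlinarith [sq_nonneg (6 * w * t - (1 + w) ^ 2), mul_pos (sub_pos.2 hw) (sub_pos.2 hw)]
  have dl : HasDerivAt (fun t : ℝ => w ^ 2 - w + 1 + 3 * w * t) (3 * w) t := by
    simpa using ((hasDerivAt_id t).const_mul (3 * w)).const_add (w ^ 2 - w + 1)
  have dQ : HasDerivAt (fun t : ℝ =>
      (w ^ 2 - w + 1) * (1 + w) ^ 2 - 3 * w * (1 + w) ^ 2 * t + 9 * w ^ 2 * t ^ 2)
      (3 * w * (6 * w * t - (1 + w) ^ 2)) t := by
    have := (((hasDerivAt_id t).const_mul (3 * w * (1 + w) ^ 2)).const_sub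
      ((w ^ 2 - w + 1) * (1 + w) ^ 2)).add ((hasDerivAt_pow 2 t).const_mul (9 * w ^ 2))
    convert! this using 1
    simp; ring
  have dX : HasDerivAt (fun t : ℝ => (6 * w * t - (1 + w) ^ 2) / (√3 * (w ^ 2 - 1)))
      (6 * w / (√3 * (w ^ 2 - 1))) t := by
    simpa using (((hasDerivAt_id t).const_mul (6 * w)).sub_const ((1 + w) ^ 2)).div_const
      (√3 * (w ^ 2 - 1))
  have h := ((((dl.log hl).const_mul (2 / 3)).sub ((dQ.log hQ.ne').const_mul (1 / 3))).const_mul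
    (2 * (w - 1 / w) - (w ^ 2 - 1 / w ^ 2))).add ((dX.arctan.const_mul (2 / √3)).const_mul
    (2 * (w + 1 / w) + (w ^ 2 + 1 / w ^ 2))) |>.const_mul
      (w ^ 3 * (w ^ 3 + 1) / (3 * (w ^ 3 - 1) ^ 3))
  convert! h using 1
  have e : 1 + ((6 * w * t - (1 + w) ^ 2) / (√3 * (w ^ 2 - 1))) ^ 2 =
      4 * ((w ^ 2 - w + 1) * (1 + w) ^ 2 - 3 * w * (1 + w) ^ 2 * t + 9 * w ^ 2 * t ^ 2) /
        (3 * (w ^ 2 - 1) ^ 2) := by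
    rw [div_pow, mul_pow, h3]
    field_simp
    ring
  have e2 : 2 / √3 * (1 / (1 + ((6 * w * t - (1 + w) ^ 2) / (√3 * (w ^ 2 - 1))) ^ 2) *
      (6 * w / (√3 * (w ^ 2 - 1)))) = 3 * w * (w ^ 2 - 1) /
      ((w ^ 2 - w + 1) * (1 + w) ^ 2 - 3 * w * (1 + w) ^ 2 * t + 9 * w ^ 2 * t ^ 2) := by
    rw [e]
    field_simp
    rw [h3]; ring
  rw [e2]
  generalize hq : (w ^ 2 - w + 1) * (1 + w) ^ 2 - 3 * w * (1 + w) ^ 2 * t + 9 * w ^ 2 * t ^ 2 = q at *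
  have hq' := hQ.ne'
  generalize hll : w ^ 2 - w + 1 + 3 * w * t = l at *
  field_simp
  rw [← hq, ← hll]
  ring

/-- The generating function of `1 / C(3k, k)` in the uniformizing variable `w`. -/
theorem hasSum_pow_div_choose_closed_form {w : ℝ} (hw : 1 < w ^ 2)
    (hy : |27 * w ^ 3 / (1 + w ^ 3) ^ 2| < 27 / 4) :
    HasSum (fun n : ℕ => (27 * w ^ 3 / (1 + w ^ 3) ^ 2) ^ (n + 1) /
        ((3 * (n + 1)).choose (n + 1) : ℝ))
      (4 * w ^ 3 / (w ^ 3 - 1) ^ 2 + w ^ 3 * (w ^ 3 + 1) / (3 * (w ^ 3 - 1) ^ 3) * (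
        2 * √3 * (2 * (w + 1 / w) + (w ^ 2 + 1 / w ^ 2)) * Real.arctan (√3 / (2 * w - 1)) -
        (2 * (w - 1 / w) - (w ^ 2 - 1 / w ^ 2)) * Real.log ((w ^ 2 - w + 1) / (1 + w) ^ 2))) := by
  have h3 : √3 ^ 2 = 3 := Real.sq_sqrt (by norm_num)
  have hw0 : w ≠ 0 := by rintro h; nlinarith
  have hD : 0 < w ^ 2 - w + 1 := by nlinarith [sq_nonneg (w - 1)]
  have hm : w - 1 ≠ 0 := by rintro h; nlinarith
  have hp : 1 + w ≠ 0 := by rintro h; nlinarith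
  have h1 : w ^ 3 - 1 ≠ 0 := by
    rw [show w ^ 3 - 1 = (w - 1) * (w ^ 2 + w + 1) by ring]
    exact mul_ne_zero hm (by nlinarith [sq_nonneg (w + 1)])
  have h2 : 1 + w ^ 3 ≠ 0 := by
    rw [show 1 + w ^ 3 = (1 + w) * (w ^ 2 - w + 1) by ring]
    exact mul_ne_zero hp hD.ne'
  set y := 27 * w ^ 3 / (1 + w ^ 3) ^ 2 with hy_def
  have hy4 : 4 * y - 27 ≠ 0 := by have := (abs_lt.1 hy).2; linarith
  have hy4' : 4 * y - 27 = -27 * (w ^ 3 - 1) ^ 2 / (1 + w ^ 3) ^ 2 := by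
    rw [hy_def]; field_simp; ring
  have hP : ∀ t ∈ Set.Icc (0 : ℝ) 1, 1 - y * (t ^ 2 * (1 - t)) ≠ 0 := by
    intro t ht h
    have h5 := abs_sq_mul_one_sub_le ht.1 ht.2
    have h6 : |y * (t ^ 2 * (1 - t))| < 1 := by
      rw [abs_mul]
      nlinarith [abs_nonneg y]
    linarith [le_abs_self (y * (t ^ 2 * (1 - t)))]
  -- The reason for the parametrization: t = -(w² - w + 1)/(3w) is a root of the cubic.
  have hfac : ∀ t, 1 - y * (t ^ 2 * (1 - t)) = (w ^ 2 - w + 1 + 3 * w * t) *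
      ((w ^ 2 - w + 1) * (1 + w) ^ 2 - 3 * w * (1 + w) ^ 2 * t + 9 * w ^ 2 * t ^ 2) /
        (1 + w ^ 3) ^ 2 := by
    intro t
    rw [hy_def]; field_simp; ring
  have hne : ∀ t ∈ Set.uIcc (0 : ℝ) 1, w ^ 2 - w + 1 + 3 * w * t ≠ 0 ∧
      (w ^ 2 - w + 1) * (1 + w) ^ 2 - 3 * w * (1 + w) ^ 2 * t + 9 * w ^ 2 * t ^ 2 ≠ 0 := by
    intro t ht
    rw [Set.uIcc_of_le zero_le_one] at ht
    have hPt := hP t ht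
    rw [hfac] at hPt
    exact mul_ne_zero_iff.1 (div_ne_zero_iff.1 hPt).1
  have hd := fun (t : ℝ) (ht : t ∈ Set.uIcc (0 : ℝ) 1) => ((hasDerivAt_hermite_part hy4
    (hP t (by rwa [Set.uIcc_of_le zero_le_one] at ht))).add
    (hasDerivAt_log_arctan_part hw (hne t ht).1 h1)).congr_deriv
    (g' := y * t ^ 2 / (1 - y * (t ^ 2 * (1 - t))) ^ 2) (by
      obtain ⟨hl, hQ⟩ := hne t ht
      rw [add_assoc, add_eq_left, hy4', hfac]
      generalize (w ^ 2 - w + 1) * (1 + w) ^ 2 - 3 * w * (1 + w) ^ 2 * t + 9 * w ^ 2 * t ^ 2 = q at *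
      generalize w ^ 2 - w + 1 + 3 * w * t = l at *
      rw [hy_def]
      field_simp
      ring)
  have hc : ContinuousOn (fun t : ℝ => y * t ^ 2 / (1 - y * (t ^ 2 * (1 - t))) ^ 2) (Set.uIcc 0 1) := by
    rw [Set.uIcc_of_le zero_le_one]
    exact ContinuousOn.div (by fun_prop) (by fun_prop) fun t ht => pow_ne_zero 2 (hP t ht)
  have hint := intervalIntegral.integral_eq_sub_of_hasDerivAt hd hc.intervalIntegrable
  have hsum := hasSum_pow_div_choose hy
  rw [hint] at hsum
  convert hsum using 1
  have hA := arctan_sub_arctan_eq hw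
  simp only [Pi.add_apply, mul_zero, mul_one, add_zero, sub_zero, zero_sub, ne_eq,
    OfNat.ofNat_ne_zero, not_false_eq_true, zero_pow, one_pow, sub_self]
  -- At t = 1 the linear factor is (1+w)² and the quadratic one is (w² - w + 1)², so all logarithms
  -- merge into a single one.
  rw [show w ^ 2 - w + 1 + 3 * w = (1 + w) ^ 2 by ring,
    show (w ^ 2 - w + 1) * (1 + w) ^ 2 - 3 * w * (1 + w) ^ 2 + 9 * w ^ 2 = (w ^ 2 - w + 1) ^ 2 by ring,
    Real.log_mul hD.ne' (pow_ne_zero 2 hp), show Real.log ((w ^ 2 - w + 1) ^ 2) = 2 * Real.log (w ^ 2 - w + 1) by simp,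
    Real.log_div hD.ne' (pow_ne_zero 2 hp),
    eq_add_of_sub_eq hA]
  -- Increment of the Hermite part: the cubic equals 1 at both end points.
  have hr : 4 * w ^ 3 / (w ^ 3 - 1) ^ 2 = (9 + 2 * y - 6 * y) / (4 * y - 27) - 9 / (4 * y - 27) := by
    rw [hy4', hy_def]
    field_simp
    ring
  have hs3 : 2 / √3 * 3 = 2 * √3 := by
    rw [div_mul_eq_mul_div, div_eq_iff (by positivity)]; linarith
  rw [hr, ← hs3]
  ring

/-! ### Cube roots, Lucas numbers and signs. -/

theorem cbrt_eq_of_pow_three_eq {x z : ℝ} (h : z ^ 3 = x) : cbrt x = z :=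
  (Odd.strictMono_pow (by decide : Odd 3)).injective ((cbrt_pow_three x).trans h.symm)

theorem coe_lucas_eq (n : ℕ) : (lucas n : ℝ) = Real.goldenRatio ^ n + Real.goldenConj ^ n := by
  induction n using Nat.twoStepInduction with
  | zero => norm_num [lucas]
  | one => simp [lucas]
  | more n h0 h1 =>
    have hg := Real.goldenRatio_sq
    have hc := Real.goldenConj_sq
    rw [lucas]
    push_cast
    rw [h0, h1]
    linear_combination (-Real.goldenRatio ^ n) * hg - Real.goldenConj ^ n * hc

/-- Since σ² = 1, σ^n = σ · σ^(n+1): the alternating sign enters the power series variable at the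
cost of one factor σ in front. -/
theorem sign_pow_mul_div_eq {σ : ℝ} (hσ : σ ^ 2 = 1) (c C X : ℝ) (n : ℕ) :
    σ ^ n * c ^ (n + 1) / (C * X ^ (2 * (n + 1))) = σ * ((σ * c / X ^ 2) ^ (n + 1) / C) := by
  have h : σ * σ ^ (n + 1) = σ ^ n := by rw [pow_succ]; linear_combination σ ^ n * hσ
  rw [div_pow, mul_pow, ← h, pow_mul X]
  ring

theorem three_le_lucas (n : ℕ) : 3 ≤ lucas (n + 2) := by
  induction n using Nat.twoStepInduction with
  | zero => simp [lucas]
  | one => simp [lucas]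
  | more n h0 h1 => rw [lucas]; omega

/-! ### Specialization of the closed form to w = ∓s b². -/

/-- For each sign s the arguments of log and arctan are matched first (oddness of arctan when w <
0); what remains is a rational identity in b, linear in the two transcendental values. -/
theorem closed_form_fib {b s F L : ℝ} (hb : 1 < b) (hs : s = 1 ∨ s = -1)
    (hF : √5 * F = b ^ 3 - s / b ^ 3) (hL : L = b ^ 3 + s / b ^ 3) {w : ℝ} (hw : w = -s * b ^ 2) :
    -s * (4 * w ^ 3 / (w ^ 3 - 1) ^ 2 + w ^ 3 * (w ^ 3 + 1) / (3 * (w ^ 3 - 1) ^ 3) * (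
        2 * √3 * (2 * (w + 1 / w) + (w ^ 2 + 1 / w ^ 2)) * Real.arctan (√3 / (2 * w - 1)) -
        (2 * (w - 1 / w) - (w ^ 2 - 1 / w ^ 2)) * Real.log ((w ^ 2 - w + 1) / (1 + w) ^ 2))) =
    4 / L ^ 2
        + 2 * √15 / 3 * (F / L ^ 3)
          * (2 * (b ^ 2 + 1 / b ^ 2) - s * (b ^ 4 + 1 / b ^ 4))
          * Real.arctan (√3 / (2 * b ^ 2 + s))
        + s * √5 / 3 * (F / L ^ 3)
          * (2 * (b ^ 2 - 1 / b ^ 2) + s * (b ^ 4 - 1 / b ^ 4))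
          * Real.log (√5 * b ^ 3 * F / (b ^ 2 - s) ^ 3) := by
  have h15 : √15 = √3 * √5 := by rw [← Real.sqrt_mul (by norm_num)]; norm_num
  have hb0 : b ≠ 0 := by positivity
  have hb2 : 1 < b ^ 2 := one_lt_pow₀ hb two_ne_zero
  have hb6 : 1 < b ^ 6 := one_lt_pow₀ hb (by norm_num)
  have n1 : b ^ 2 - 1 ≠ 0 := by linarith
  have n2 : b ^ 2 + 1 ≠ 0 := by positivity
  have n3 : b ^ 6 - 1 ≠ 0 := by linarith
  have n4 : b ^ 6 + 1 ≠ 0 := by positivity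
  have e1 : 2 * √15 / 3 * (F / L ^ 3) = 2 * √3 / 3 * ((b ^ 3 - s / b ^ 3) / L ^ 3) := by
    rw [← hF, h15]; ring
  have e2 : s * √5 / 3 * (F / L ^ 3) = s / 3 * ((b ^ 3 - s / b ^ 3) / L ^ 3) := by
    rw [← hF]; ring
  have e3 : √5 * b ^ 3 * F = b ^ 3 * (b ^ 3 - s / b ^ 3) := by rw [← hF]; ring
  rw [e1, e2, e3, hL, hw]
  clear e1 e2 e3 hF hL hw
  rcases hs with rfl | rfl
  · have hl : b ^ 3 * (b ^ 3 - 1 / b ^ 3) / (b ^ 2 - 1) ^ 3 =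
        ((-1 * b ^ 2) ^ 2 - -1 * b ^ 2 + 1) / (1 + -1 * b ^ 2) ^ 2 := by
      rw [show (1 + -1 * b ^ 2) ^ 2 = (b ^ 2 - 1) ^ 2 by ring]
      field_simp
      ring
    have ha : √3 / (2 * (-1 * b ^ 2) - 1) = -(√3 / (2 * b ^ 2 + 1)) := by
      rw [← div_neg]; ring_nf
    rw [hl, ha, Real.arctan_neg]
    generalize Real.arctan _ = θ
    generalize Real.log _ = l
    rw [show (-1 * b ^ 2) ^ 3 - 1 = -(b ^ 6 + 1) by ring,
      show b ^ 3 + 1 / b ^ 3 = (b ^ 6 + 1) / b ^ 3 by field_simp]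
    field_simp
    ring
  · have hl : b ^ 3 * (b ^ 3 - -1 / b ^ 3) / (b ^ 2 - -1) ^ 3 =
        ((- -1 * b ^ 2) ^ 2 - - -1 * b ^ 2 + 1) / (1 + - -1 * b ^ 2) ^ 2 := by
      rw [show (1 + - -1 * b ^ 2) ^ 2 = (b ^ 2 + 1) ^ 2 by ring, sub_neg_eq_add (b ^ 2)]
      field_simp
      ring
    have ha : √3 / (2 * (- -1 * b ^ 2) - 1) = √3 / (2 * b ^ 2 + -1) := by ring_nf
    rw [hl, ha]
    generalize Real.arctan _ = θ
    generalize Real.log _ = l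
    rw [show (- -1 * b ^ 2) ^ 3 - 1 = b ^ 6 - 1 by ring,
      show b ^ 3 + -1 / b ^ 3 = (b ^ 6 - 1) / b ^ 3 by field_simp; ring]
    field_simp
    ring

theorem closed_form_lucas {b s F L : ℝ} (hb : 1 < b) (hs : s = 1 ∨ s = -1)
    (hF : √5 * F = b ^ 3 - s / b ^ 3) (hL : L = b ^ 3 + s / b ^ 3) {w : ℝ} (hw : w = s * b ^ 2) :
    s * (4 * w ^ 3 / (w ^ 3 - 1) ^ 2 + w ^ 3 * (w ^ 3 + 1) / (3 * (w ^ 3 - 1) ^ 3) * (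
        2 * √3 * (2 * (w + 1 / w) + (w ^ 2 + 1 / w ^ 2)) * Real.arctan (√3 / (2 * w - 1)) -
        (2 * (w - 1 / w) - (w ^ 2 - 1 / w ^ 2)) * Real.log ((w ^ 2 - w + 1) / (1 + w) ^ 2))) =
    4 / (5 * F ^ 2)
          + 2 * √15 / 75 * (L / F ^ 3)
            * (2 * (b ^ 2 + 1 / b ^ 2) + s * (b ^ 4 + 1 / b ^ 4))
            * Real.arctan (√3 / (2 * b ^ 2 - s))
          - s * √5 / 75 * (L / F ^ 3)
            * (2 * (b ^ 2 - 1 / b ^ 2) - s * (b ^ 4 - 1 / b ^ 4))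
            * Real.log (L / (b + s / b) ^ 3) := by
  have h15 : √15 = √3 * √5 := by rw [← Real.sqrt_mul (by norm_num)]; norm_num
  have h5 : √5 ^ 2 = 5 := Real.sq_sqrt (by norm_num)
  have h5' : √5 ≠ 0 := by positivity
  have hb0 : b ≠ 0 := by positivity
  have hb2 : 1 < b ^ 2 := one_lt_pow₀ hb two_ne_zero
  have hb6 : 1 < b ^ 6 := one_lt_pow₀ hb (by norm_num)
  have n1 : b ^ 2 - 1 ≠ 0 := by linarith
  have n2 : b ^ 2 + 1 ≠ 0 := by positivity
  have n3 : b ^ 6 - 1 ≠ 0 := by linarith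
  have n4 : b ^ 6 + 1 ≠ 0 := by positivity
  have e0 : √5 / 75 * (L / F ^ 3) = 1 / 3 * (L / (b ^ 3 - s / b ^ 3) ^ 3) := by
    have : √5 / 75 = 1 / (3 * √5 ^ 3) * 1 := by
      field_simp
      linear_combination 3 * (√5 ^ 2 + 5) * h5
    rw [← hF, mul_pow, this]
    ring
  have e1 : 2 * √15 / 75 * (L / F ^ 3) = 2 * √3 / 3 * (L / (b ^ 3 - s / b ^ 3) ^ 3) := by
    rw [h15]; linear_combination 2 * √3 * e0
  have e2 : s * √5 / 75 * (L / F ^ 3) = s / 3 * (L / (b ^ 3 - s / b ^ 3) ^ 3) := by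
    linear_combination s * e0
  have e3 : 5 * F ^ 2 = (b ^ 3 - s / b ^ 3) ^ 2 := by rw [← hF, mul_pow, h5]
  rw [e1, e2, e3, hL, hw]
  clear e0 e1 e2 e3 hF hL hw
  rcases hs with rfl | rfl
  · have hl : (b ^ 3 + 1 / b ^ 3) / (b + 1 / b) ^ 3 =
        ((1 * b ^ 2) ^ 2 - 1 * b ^ 2 + 1) / (1 + 1 * b ^ 2) ^ 2 := by
      rw [show b + 1 / b = (b ^ 2 + 1) / b by field_simp,
        show (1 + 1 * b ^ 2) ^ 2 = (b ^ 2 + 1) ^ 2 by ring]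
      field_simp
      ring
    rw [hl, one_mul (b ^ 2)]
    generalize Real.arctan _ = θ
    generalize Real.log _ = l
    rw [show (b ^ 2) ^ 3 - 1 = b ^ 6 - 1 by ring,
      show b ^ 3 - 1 / b ^ 3 = (b ^ 6 - 1) / b ^ 3 by field_simp]
    field_simp
    ring
  · have hl : (b ^ 3 + -1 / b ^ 3) / (b + -1 / b) ^ 3 =
        ((-1 * b ^ 2) ^ 2 - -1 * b ^ 2 + 1) / (1 + -1 * b ^ 2) ^ 2 := by
      rw [show b + -1 / b = (b ^ 2 - 1) / b by field_simp; ring,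
        show (1 + -1 * b ^ 2) ^ 2 = (b ^ 2 - 1) ^ 2 by ring]
      field_simp
      ring
    have ha : √3 / (2 * (-1 * b ^ 2) - 1) = -(√3 / (2 * b ^ 2 - -1)) := by
      rw [← div_neg]; ring_nf
    rw [hl, ha, Real.arctan_neg]
    generalize Real.arctan _ = θ
    generalize Real.log _ = l
    rw [show (-1 * b ^ 2) ^ 3 - 1 = -(b ^ 6 + 1) by ring,
      show b ^ 3 - -1 / b ^ 3 = (b ^ 6 + 1) / b ^ 3 by field_simp; ring]
    field_simp
    ring

/-! ### The two evaluations. -/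

theorem theorem6 (r : ℕ) (hr : 0 < r) (α β F L : ℝ)
    (hα : α = (1 + √5) / 2) (hβ : β = (1 - √5) / 2)
    (hF : F = (Nat.fib r : ℝ)) (hL : L = (lucas r : ℝ)) :
    -- the summation index is `k = n + 1`, with `n` running through `0, 1, 2, …`
    HasSum
      (fun n : ℕ =>
        (-1 : ℝ) ^ (n * (r - 1)) * (27 / 5 : ℝ) ^ (n + 1) /
          (((3 * (n + 1)).choose (n + 1) : ℝ) * F ^ (2 * (n + 1))))
      (4 / L ^ 2
        + 2 * √15 / 3 * (F / L ^ 3)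
          * (2 * (cbrt (α ^ (2 * r)) + cbrt (β ^ (2 * r)))
              - (-1) ^ r * (cbrt (α ^ (4 * r)) + cbrt (β ^ (4 * r))))
          * Real.arctan (√3 / (2 * cbrt (α ^ (2 * r)) + (-1) ^ r))
        + (-1) ^ r * √5 / 3 * (F / L ^ 3)
          * (2 * (cbrt (α ^ (2 * r)) - cbrt (β ^ (2 * r)))
              + (-1) ^ r * (cbrt (α ^ (4 * r)) - cbrt (β ^ (4 * r))))
          * Real.log (√5 * α ^ r * F / (cbrt (α ^ (2 * r)) - (-1) ^ r) ^ 3))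
    ∧
    (r ≠ 1 →
      HasSum
        (fun n : ℕ =>
          (-1 : ℝ) ^ (r * n) * (27 : ℝ) ^ (n + 1) /
            (((3 * (n + 1)).choose (n + 1) : ℝ) * L ^ (2 * (n + 1))))
        (4 / (5 * F ^ 2)
          + 2 * √15 / 75 * (L / F ^ 3)
            * (2 * (cbrt (α ^ (2 * r)) + cbrt (β ^ (2 * r)))
                + (-1) ^ r * (cbrt (α ^ (4 * r)) + cbrt (β ^ (4 * r))))
            * Real.arctan (√3 / (2 * cbrt (α ^ (2 * r)) - (-1) ^ r))
          - (-1) ^ r * √5 / 75 * (L / F ^ 3)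
            * (2 * (cbrt (α ^ (2 * r)) - cbrt (β ^ (2 * r)))
                - (-1) ^ r * (cbrt (α ^ (4 * r)) - cbrt (β ^ (4 * r))))
            * Real.log (L / (cbrt (α ^ r) + cbrt (β ^ r)) ^ 3))) := by
  obtain ⟨s, hs_def⟩ : ∃ s : ℝ, s = (-1) ^ r := ⟨_, rfl⟩
  have hs : s = 1 ∨ s = -1 := hs_def ▸ neg_one_pow_eq_or ℝ r
  have hss : s ^ 2 = 1 := by rcases hs with rfl | rfl <;> norm_num
  have hαg : α = Real.goldenRatio := hα
  have hβg : β = Real.goldenConj := hβ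
  have hα0 : 0 < α := hαg ▸ Real.goldenRatio_pos
  have hα1 : 1 < α := hαg ▸ Real.one_lt_goldenRatio
  have hαβ : α ^ r * β ^ r = s := by
    rw [← mul_pow, hαg, hβg, Real.goldenRatio_mul_goldenConj, hs_def]
  obtain ⟨b, hb_def⟩ : ∃ b : ℝ, b = cbrt (α ^ r) := ⟨_, rfl⟩
  have hb3 : b ^ 3 = α ^ r := hb_def ▸ cbrt_pow_three _
  have hb : 1 < b := by
    by_contra! h
    have h1 : 1 < b ^ 3 := hb3 ▸ one_lt_pow₀ hα1 hr.ne'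
    nlinarith [(Odd.strictMono_pow (R := ℝ) (by decide : Odd 3)).monotone h]
  have hb0 : b ≠ 0 := by positivity
  have hβr : β ^ r = s / b ^ 3 := by
    rw [hb3, ← hαβ]; field_simp
  have hGF : √5 * F = b ^ 3 - s / b ^ 3 := by
    rw [hF, Real.coe_fib_eq, ← hαg, ← hβg, ← hβr, ← hb3]; field_simp
  have hbL : L = b ^ 3 + s / b ^ 3 := by
    rw [hL, coe_lucas_eq, ← hαg, ← hβg, ← hβr, ← hb3]
  have hF1 : 1 ≤ F := by rw [hF]; exact_mod_cast Nat.fib_pos.2 hr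
  have h5F : 5 * F ^ 2 = (b ^ 3 - s / b ^ 3) ^ 2 := by
    rw [← hGF, mul_pow, Real.sq_sqrt (by norm_num)]
  have c1 : cbrt (α ^ (2 * r)) = b ^ 2 := cbrt_eq_of_pow_three_eq (by
    rw [mul_comm, pow_mul, ← hb3]; ring)
  have c2 : cbrt (α ^ (4 * r)) = b ^ 4 := cbrt_eq_of_pow_three_eq (by
    rw [mul_comm, pow_mul, ← hb3]; ring)
  have c3 : cbrt (β ^ (2 * r)) = 1 / b ^ 2 := cbrt_eq_of_pow_three_eq (by
    rw [mul_comm, pow_mul, hβr, div_pow s, hss]; ring)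
  have c4 : cbrt (β ^ (4 * r)) = 1 / b ^ 4 := cbrt_eq_of_pow_three_eq (by
    rw [mul_comm, pow_mul, hβr, div_pow s, show s ^ 4 = (s ^ 2) ^ 2 by ring, hss]; ring)
  have c5 : cbrt (β ^ r) = s / b := cbrt_eq_of_pow_three_eq (by
    rw [hβr, div_pow, show s ^ 3 = s ^ 2 * s by ring, hss, one_mul])
  have hw2 : 1 < b ^ 4 := one_lt_pow₀ hb (by norm_num)
  rw [c1, c2, c3, c4, c5, ← hb_def, ← hb3, ← hs_def]
  refine ⟨?_, fun hr1 => ?_⟩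
  · have hy : 27 * (-s * b ^ 2) ^ 3 / (1 + (-s * b ^ 2) ^ 3) ^ 2 = -s * (27 / 5) / F ^ 2 := by
      have hF2 : F ^ 2 = (b ^ 6 - s) ^ 2 / (5 * b ^ 6) := by
        rw [eq_div_iff (by positivity)]
        have : b ^ 6 - s = b ^ 3 * (b ^ 3 - s / b ^ 3) := by field_simp
        rw [this, mul_pow, ← h5F]; ring
      have hn : b ^ 6 - s ≠ 0 := by
        intro h
        rw [h] at hF2
        norm_num at hF2
        linarith
      have h1 : 1 + (-s * b ^ 2) ^ 3 = -s * (b ^ 6 - s) := by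
        linear_combination (-s * b ^ 6 - 1) * hss
      have h2 : (-s * b ^ 2) ^ 3 = -s * b ^ 6 := by linear_combination (-s * b ^ 6) * hss
      rw [h1, h2, hF2, mul_pow, neg_sq, hss]
      field_simp
    -- Here |y| = (27/5)/F², and F ≥ 1 suffices because 27/5 < 27/4.
    have hlt : |27 * (-s * b ^ 2) ^ 3 / (1 + (-s * b ^ 2) ^ 3) ^ 2| < 27 / 4 := by
      have : |s| = 1 := by rcases hs with rfl | rfl <;> norm_num
      rw [hy, abs_div, abs_mul, abs_neg, this, abs_of_pos (by positivity : (0 : ℝ) < F ^ 2),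
        div_lt_iff₀ (by positivity)]
      norm_num
      nlinarith
    have h := (hasSum_pow_div_choose_closed_form
      (by rw [mul_pow, neg_sq, hss]; linarith) hlt).mul_left (-s)
    rw [closed_form_fib hb hs hGF hbL rfl] at h
    refine h.congr_fun ?_
    intro n
    rw [hy]
    -- As r ≥ 1, the truncated subtraction is genuine and (-1)^(r-1) = -s.
    have h3 : (-1 : ℝ) ^ (n * (r - 1)) = (-s) ^ n := by
      rw [mul_comm, pow_mul]
      congr 1
      rw [hs_def]
      obtain ⟨k, rfl⟩ := Nat.exists_eq_succ_of_ne_zero hr.ne'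
      simp [pow_succ]
    rw [h3]
    exact sign_pow_mul_div_eq (by rw [neg_sq, hss]) _ _ _ n
  -- This is where r = 1 must be excluded: L_1 = 1 would give |y| = 27, outside the disc, while L ≥
  -- 3 gives |y| ≤ 3.
  · have hL3 : 3 ≤ L := by
      obtain ⟨k, rfl⟩ : ∃ k, r = k + 2 := ⟨r - 2, by omega⟩
      rw [hL]
      exact_mod_cast three_le_lucas k
    have hL0 : L ≠ 0 := by linarith
    have hy : 27 * (s * b ^ 2) ^ 3 / (1 + (s * b ^ 2) ^ 3) ^ 2 = s * 27 / L ^ 2 := by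
      have hn : b ^ 6 + s = b ^ 3 * L := by rw [hbL]; field_simp
      have h1 : 1 + (s * b ^ 2) ^ 3 = s * (b ^ 6 + s) := by
        linear_combination (s * b ^ 6 - 1) * hss
      have h2 : (s * b ^ 2) ^ 3 = s * b ^ 6 := by linear_combination (s * b ^ 6) * hss
      rw [h1, h2, hn, mul_pow, hss]
      field_simp
    have hlt : |27 * (s * b ^ 2) ^ 3 / (1 + (s * b ^ 2) ^ 3) ^ 2| < 27 / 4 := by
      have : |s| = 1 := by rcases hs with rfl | rfl <;> norm_num
      rw [hy, abs_div, abs_mul, this, abs_of_pos (by positivity : (0 : ℝ) < L ^ 2),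
        div_lt_iff₀ (by positivity)]
      norm_num
      nlinarith
    have h := (hasSum_pow_div_choose_closed_form
      (by rw [mul_pow, hss]; linarith) hlt).mul_left s
    rw [closed_form_lucas hb hs hGF hbL rfl] at h
    refine h.congr_fun ?_
    intro n
    rw [hy, pow_mul, ← hs_def]
    exact sign_pow_mul_div_eq hss _ _ _ n
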